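/- Let $\langle M,E\rangle$ be a model of ZFC (not necessarily transitive or well-founded), and suppose that $M\models$ "$\langle X,\tau\rangle$ is a regular Hausdorff topological space" ($X,\tau\in M$, $\tau$ being the set of open sets; the extensions $\{x\in M: M\models x\in X\}$ and $\{O\in M: M\models O\in\tau\}$, which are assumed to be sets, are again denoted $X$ and $\tau$). A *(topological) preinterpretation* of $\langle X,\tau\rangle$ over $M$ is a $T_0$ topological space $\langle\hat X,\hat\tau\rangle$ together with maps $\pi\colon X\to\hat X$ and $\pi\colon\tau\to\hat\tau$ such that 1. for all $x\in X$ and $O\in\tau$: $M\models x\in O$ if and only if $\pi(x)\in\pi(O)$; 2. $\pi$ commutes with finite intersections and arbitrary unions of open sets in $M$: if $F\in M$, $M\models$ "$F\subseteq\tau$ is finite and $P=\bigcap F$" and $P\in\tau$, then $\pi(P)=\bigcap\{\pi(Q): M\models Q\in F\}$ (with $\bigcap\emptyset$ read as the whole space); and if $C\in M$, $M\models$ "$C\subseteq\tau$ and $O=\bigcup C$" and $O\in\tau$, then $\pi(O)=\bigcup\{\pi(Q): M\models Q\in C\}$; 3. $\pi(\emptyset)=\emptyset$ and $\pi(X)=\hat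 X$; 4. $\{\pi(O): O\in\tau\}$ is a basis of the topology $\hat\tau$. For preinterpretations $\pi_0\colon X\to\hat X_0$ and $\pi_1\colon X\to\hat X_1$, a *reduction* of $\pi_0$ to $\pi_1$ is a map $h\colon\hat X_0\to\hat X_1$ such that $\pi_1(x)=h(\pi_0(x))$ for every $x\in X$ and $h^{-1}(\pi_1(O))=\pi_0(O)$ for every $O\in\tau$. Write $\pi_0\le\pi_1$ if such a reduction exists; $\pi_0$ and $\pi_1$ are *equivalent* if there is a reduction of $\pi_0$ to $\pi_1$ which is a bijection of $\hat X_0$ and $\hat X_1$. An *interpretation* of $\langle X,\tau\rangle$ is a $\le$-largest preinterpretation, i.e. a preinterpretation $\pi$ such that $\pi'\le\pi$ for every preinterpretation $\pi'$. **Theorem.** An interpretation of $\langle X,\tau\rangle$ exists, any two interpretations of $\langle X,\tau\rangle$ are equivalent, and the target space $\hat X$ of an interpretation is regular Hausdorff. -/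

import Mathlib

universe u w

namespace SetModel

/-- The only symbol of the language of set theory: the binary relation symbol `∈`. -/
inductive MemSymbol : ℕ → Type
  | mem : MemSymbol 2

/-- The first-order language of set theory. -/
def langSet : FirstOrder.Language where
  Functions := fun _ => Empty
  Relations := MemSymbol

/-- The structure `⟨M, E⟩` for the language of set theory. -/
abbrev memStructure {M : Type u} (E : M → M → Prop) : langSet.Structure M where
  funMap := fun f => Empty.elim f
  RelMap := fun r => match r with
    | MemSymbol.mem => fun v => E (v 0) (v 1)

/-- `⟨M, E⟩ ⊨ φ[v]`, where the free variables of `φ` are numbered by natural numbers. -/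
def Sat {M : Type u} (E : M → M → Prop) (φ : langSet.Formula ℕ) (v : ℕ → M) : Prop :=
  @FirstOrder.Language.Formula.Realize langSet M (memStructure E) ℕ φ v

/-- `⟨M, E⟩ ⊨ ZFC`. Neither well-foundedness nor transitivity of `⟨M, E⟩` is required. -/
structure IsModelZFC {M : Type u} (E : M → M → Prop) : Prop where
  extensionality : ∀ a b, (∀ x, E x a ↔ E x b) → a = b
  foundation : ∀ a, (∃ x, E x a) → ∃ x, E x a ∧ ∀ y, E y x → ¬ E y a
  pairing : ∀ a b, ∃ c, ∀ x, E x c ↔ x = a ∨ x = b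
  union : ∀ a, ∃ b, ∀ x, E x b ↔ ∃ y, E y a ∧ E x y
  powerset : ∀ a, ∃ b, ∀ x, E x b ↔ ∀ y, E y x → E y a
  infinity : ∃ a, (∃ e, E e a ∧ ∀ x, ¬ E x e) ∧
    ∀ x, E x a → ∃ s, E s a ∧ ∀ y, E y s ↔ E y x ∨ y = x
  /-- Separation for `φ`; variable `0` ranges over the elements, the others are parameters. -/
  separation : ∀ (φ : langSet.Formula ℕ) (v : ℕ → M) (a : M),
    ∃ b, ∀ x, E x b ↔ E x a ∧ Sat E φ (Function.update v 0 x)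
  /-- Replacement for `φ`; variable `0` is the argument, variable `1` is the value, the others
  are parameters. -/
  replacement : ∀ (φ : langSet.Formula ℕ) (v : ℕ → M) (a : M),
    (∀ x, E x a → ∀ y z, Sat E φ (Function.update (Function.update v 0 x) 1 y) →
      Sat E φ (Function.update (Function.update v 0 x) 1 z) → y = z) →
    ∃ b, ∀ y, E y b ↔ ∃ x, E x a ∧ Sat E φ (Function.update (Function.update v 0 x) 1 y)
  /-- Every set of nonempty pairwise disjoint sets has a transversal. -/
  choice : ∀ a, (∀ x, E x a → ∃ z, E z x) →
    (∀ x y, E x a → E y a → ∀ z, E z x → E z y → x = y) →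
    ∃ c, ∀ x, E x a → ∃! z, E z x ∧ E z c

section Topology

variable {M : Type u} (E : M → M → Prop)

/-- The extension `{x | M ⊨ x ∈ a}` of an element `a` of `M`. -/
abbrev Ext (a : M) : Type u := {x : M // E x a}

/-- `M ⊨ a ⊆ b`. -/
def Sub (a b : M) : Prop := ∀ x, E x a → E x b

/-- `M ⊨ a = ⋃ C`. -/
def IsUnion (a C : M) : Prop := ∀ x, E x a ↔ ∃ Q, E Q C ∧ E x Q

/-- `M ⊨ a = {x ∈ X | ∀ Q ∈ F, x ∈ Q}`, the intersection of a family `F` of subsets of `X`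
(which is `X` if `F` is empty). -/
def IsInter (X a F : M) : Prop := ∀ x, E x a ↔ E x X ∧ ∀ Q, E Q F → E x Q

/-- `M ⊨ F is finite`: in `M`, every set which contains `∅` and contains `A ∪ {x}` whenever it
contains `A` and `x ∈ F`, contains `F`. -/
def IsFin (F : M) : Prop :=
  ∀ K, (∀ e, (∀ x, ¬ E x e) → E e K) →
    (∀ A x B, E A K → E x F → (∀ y, E y B ↔ E y A ∨ y = x) → E B K) → E F K

/-- `M ⊨ ⟨X, τ⟩ is a topological space`. -/
structure IsTopology (X τ : M) : Prop where
  sub : ∀ O, E O τ → Sub E O X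
  empty_mem : ∃ O, E O τ ∧ ∀ x, ¬ E x O
  whole_mem : E X τ
  inter_mem : ∀ O P, E O τ → E P τ → ∃ Q, E Q τ ∧ ∀ x, E x Q ↔ E x O ∧ E x P
  union_mem : ∀ C, Sub E C τ → ∃ O, E O τ ∧ IsUnion E O C

/-- `M ⊨ C is a closed subset of ⟨X, τ⟩`. -/
def IsClosedIn (X τ C : M) : Prop :=
  Sub E C X ∧ ∃ O, E O τ ∧ ∀ x, E x O ↔ E x X ∧ ¬ E x C

/-- `M ⊨ ⟨X, τ⟩ is a regular Hausdorff space`. -/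
structure IsRegularHausdorff (X τ : M) : Prop where
  isTopology : IsTopology E X τ
  hausdorff : ∀ x y, E x X → E y X → x ≠ y →
    ∃ U V, E U τ ∧ E V τ ∧ E x U ∧ E y V ∧ ∀ z, ¬ (E z U ∧ E z V)
  regular : ∀ C x, IsClosedIn E X τ C → E x X → ¬ E x C →
    ∃ U V, E U τ ∧ E V τ ∧ E x U ∧ Sub E C V ∧ ∀ z, ¬ (E z U ∧ E z V)

/-- A topological preinterpretation over `⟨M, E⟩` of the topological space `⟨X, τ⟩` of `M`.
All topological spaces are required to be `T₀`. -/
structure Preinterpretation (X τ : M) where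
  /-- The target space. -/
  Carrier : Type w
  [top : TopologicalSpace Carrier]
  [t0 : T0Space Carrier]
  /-- The map on points. -/
  pt : Ext E X → Carrier
  /-- The map on open sets. -/
  op : Ext E τ → Set Carrier
  mem_iff : ∀ (x : Ext E X) (O : Ext E τ), E x.1 O.1 ↔ pt x ∈ op O
  map_inter : ∀ (F : M) (P : Ext E τ), Sub E F τ → IsFin E F → IsInter E X P.1 F →
    op P = ⋂ Q ∈ {Q : Ext E τ | E Q.1 F}, op Q
  map_union : ∀ (C : M) (O : Ext E τ), Sub E C τ → IsUnion E O.1 C →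
    op O = ⋃ Q ∈ {Q : Ext E τ | E Q.1 C}, op Q
  map_empty : ∀ O : Ext E τ, (∀ x, ¬ E x O.1) → op O = ∅
  map_whole : ∀ O : Ext E τ, O.1 = X → op O = Set.univ
  basis : TopologicalSpace.IsTopologicalBasis (Set.range op)

attribute [instance] Preinterpretation.top Preinterpretation.t0

variable {E} {X τ : M}

namespace Preinterpretation

/-- `h` is a reduction of `π₀` to `π₁`. -/
def IsReduction (π₀ π₁ : Preinterpretation.{u, w} E X τ) (h : π₀.Carrier → π₁.Carrier) : Prop :=
  π₁.pt = h ∘ π₀.pt ∧ ∀ O, h ⁻¹' π₁.op O = π₀.op O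

/-- `π₀ ≤ π₁`. -/
def Reducible (π₀ π₁ : Preinterpretation.{u, w} E X τ) : Prop :=
  ∃ h : π₀.Carrier → π₁.Carrier, IsReduction π₀ π₁ h

/-- Equivalence of preinterpretations. -/
def Equivalent (π₀ π₁ : Preinterpretation.{u, w} E X τ) : Prop :=
  ∃ h : π₀.Carrier → π₁.Carrier, IsReduction π₀ π₁ h ∧ Function.Bijective h

/-- `π` is an interpretation, i.e. a `≤`-largest preinterpretation. -/
def IsInterpretation (π : Preinterpretation.{u, w} E X τ) : Prop :=
  ∀ π' : Preinterpretation.{u, w} E X τ, Reducible π' π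

end Preinterpretation

end Topology

end SetModel

/-! A point `y` of a preinterpretation determines the family of all `O ∈ τ` with `y ∈ π(O)`; it
determines `y` because the sets `π(O)` form a basis of a `T₀` topology. The axioms on `π` turn into
closure properties of this family, which define the notion of a point filter. So a
preinterpretation amounts to a set of point filters that contains the principal ones, a reduction
is an inclusion between two such sets, and the set of all point filters is the largest.

For the separation of the target space, let `O ∈ τ`. Regularity in `M` says that `O` is the union
of all `P ∈ τ` for which some `Q ∈ τ` is disjoint from `P` and satisfies `Q ∪ O = X`. By separation
these `P` form a set in `M`, so `π(O)` is the union of the corresponding `π(P)`; and `π(Q)` is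
disjoint from `π(P)` and covers the space together with `π(O)`, so the closure of `π(P)` is
contained in `π(O)`. Finally, a regular `T₀` space is Hausdorff. -/

namespace SetModel

section Axioms

variable {M : Type u} (E : M → M → Prop)

/-- The axiom of pairing, in `⟨M, E⟩`. -/
def Pairing : Prop := ∀ a b, ∃ c, ∀ x, E x c ↔ x = a ∨ x = b

/-- The axiom scheme of separation, in `⟨M, E⟩`. As in `IsModelZFC`, variable `0` ranges over the
elements and the other variables are parameters. -/
def Separation : Prop :=
  ∀ (φ : langSet.Formula ℕ) (v : ℕ → M) (a : M),
    ∃ b, ∀ x, E x b ↔ E x a ∧ Sat E φ (Function.update v 0 x)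

/-- `M ⊨ ⟨X, τ⟩ is regular`, for a topological space `⟨X, τ⟩` of `M`. -/
def IsRegular (X τ : M) : Prop :=
  ∀ C x, IsClosedIn E X τ C → E x X → ¬ E x C →
    ∃ U V, E U τ ∧ E V τ ∧ E x U ∧ Sub E C V ∧ ∀ z, ¬ (E z U ∧ E z V)

/-- `M ⊨ the closure of P is contained in O`, for subsets `P` and `O` of `X`. It is expressed by an
open set `Q`, disjoint from `P`, which covers `X` together with `O`, so that it is preserved by
preinterpretations. -/
def IsWellInside (X τ P O : M) : Prop :=
  ∃ Q, E Q τ ∧ (∀ z, E z P → ¬ E z Q) ∧ ∀ z, E z X → E z Q ∨ E z O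

end Axioms

section Formulas

open FirstOrder Language

variable {M : Type u} (E : M → M → Prop)

/-- The atomic formula `s ∈ t`, where `Sum.inl i` is the free variable `i` and `Sum.inr i` is the
bound variable `i`. -/
def memFormula {n : ℕ} (s t : ℕ ⊕ Fin n) : langSet.BoundedFormula ℕ n :=
  Relations.boundedFormula₂ (L := langSet) MemSymbol.mem (.var s) (.var t)

theorem realize_memFormula {n : ℕ} (s t : ℕ ⊕ Fin n) (v : ℕ → M) (xs : Fin n → M) :
    @BoundedFormula.Realize langSet M (memStructure E) ℕ n (memFormula s t) v xs ↔
      E (Sum.elim v xs s) (Sum.elim v xs t) :=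
  @BoundedFormula.realize_rel₂ langSet M (memStructure E) ..

/-- The formula `v₀ ∉ v₁`. -/
def notMemFormula : langSet.Formula ℕ := ∼(memFormula (.inl 0) (.inl 1))

theorem sat_notMemFormula (v : ℕ → M) : Sat E notMemFormula v ↔ ¬ E (v 0) (v 1) := by
  simp [Sat, notMemFormula, Formula.Realize, realize_memFormula]

/-- The formula expressing `IsWellInside E v₃ v₁ v₀ v₂`. -/
def wellInsideFormula : langSet.Formula ℕ :=
  ∃' (memFormula (.inr 0) (.inl 1) ⊓
    (∀' (memFormula (n := 2) (.inr 1) (.inl 0) ⟹ ∼(memFormula (.inr 1) (.inr 0))) ⊓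
      ∀' (memFormula (n := 2) (.inr 1) (.inl 3) ⟹
        (memFormula (.inr 1) (.inr 0) ⊔ memFormula (.inr 1) (.inl 2)))))

theorem sat_wellInsideFormula (v : ℕ → M) :
    Sat E wellInsideFormula v ↔ IsWellInside E (v 3) (v 1) (v 0) (v 2) := by
  simp only [Sat, wellInsideFormula, Formula.Realize, BoundedFormula.realize_ex,
    BoundedFormula.realize_inf, BoundedFormula.realize_all, BoundedFormula.realize_imp,
    BoundedFormula.realize_not, BoundedFormula.realize_sup, realize_memFormula]
  rfl

end Formulas

section Model

variable {M : Type u} {E : M → M → Prop}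

theorem Separation.exists_diff (hsep : Separation E) (a b : M) :
    ∃ c, ∀ x, E x c ↔ E x a ∧ ¬ E x b := by
  obtain ⟨c, hc⟩ := hsep notMemFormula (fun _ => b) a
  exact ⟨c, fun x => by simpa [sat_notMemFormula] using hc x⟩

theorem Separation.exists_wellInside (hsep : Separation E) (X τ O : M) :
    ∃ C, ∀ P, E P C ↔ E P τ ∧ IsWellInside E X τ P O := by
  obtain ⟨C, hC⟩ := hsep wellInsideFormula
    (fun n => if n = 1 then τ else if n = 2 then O else X) τ
  exact ⟨C, fun P => by simpa [sat_wellInsideFormula] using hC P⟩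

theorem Pairing.isFin_pair (hpair : Pairing E) {a b c e : M} (he : ∀ x, ¬ E x e)
    (hc : ∀ x, E x c ↔ x = a ∨ x = b) : IsFin E c := by
  intro K hempty hinsert
  obtain ⟨s, hs⟩ := hpair a a
  have hsK : E s K := hinsert e a s (hempty e he) ((hc a).2 (.inl rfl)) fun y => by simp [hs, he]
  exact hinsert s b c hsK ((hc b).2 (.inr rfl)) fun y => by simp [hs, hc]

variable {X τ : M}

theorem IsTopology.isClosedIn_diff (hX : IsTopology E X τ) {O D : M} (hO : E O τ)
    (hD : ∀ x, E x D ↔ E x X ∧ ¬ E x O) : IsClosedIn E X τ D := by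
  refine ⟨fun x hx => ((hD x).1 hx).1, O, hO, fun x => ?_⟩
  have hOX := hX.sub O hO x
  rw [hD]
  tauto

theorem IsRegular.exists_isWellInside (hreg : IsRegular E X τ) (hsep : Separation E)
    (hX : IsTopology E X τ) {O x : M} (hO : E O τ) (hx : E x O) :
    ∃ P, E P τ ∧ IsWellInside E X τ P O ∧ E x P := by
  obtain ⟨D, hD⟩ := hsep.exists_diff X O
  obtain ⟨U, V, hU, hV, hxU, hDV, hUV⟩ := hreg D x (hX.isClosedIn_diff hO hD)
    (hX.sub O hO x hx) fun h => ((hD x).1 h).2 hx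
  refine ⟨U, hU, ⟨V, hV, fun z hzU hzV => hUV z ⟨hzU, hzV⟩, fun z hz => ?_⟩, hxU⟩
  exact or_iff_not_imp_right.2 fun hzO => hDV z ((hD z).2 ⟨hz, hzO⟩)

theorem IsRegular.isUnion_wellInside (hreg : IsRegular E X τ) (hsep : Separation E)
    (hX : IsTopology E X τ) {O C : M} (hO : E O τ)
    (hC : ∀ P, E P C ↔ E P τ ∧ IsWellInside E X τ P O) : IsUnion E O C := by
  refine fun x => ⟨fun hx => ?_, fun ⟨P, hPC, hxP⟩ => ?_⟩
  · obtain ⟨P, hP, hPO, hxP⟩ := hreg.exists_isWellInside hsep hX hO hx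
    exact ⟨P, (hC P).2 ⟨hP, hPO⟩, hxP⟩
  · obtain ⟨hP, Q, -, hPQ, hcover⟩ := (hC P).1 hPC
    exact (hcover x (hX.sub P hP x hxP)).resolve_left (hPQ x hxP)

end Model

section PointFilter

variable {M : Type u}

/-- A family of open sets with the closure properties of the family of all `O` with `y ∈ π(O)`, for
a point `y` of a preinterpretation `π`. Only finite intersections and unions of families that belong
to `M` are considered. -/
structure PointFilter (E : M → M → Prop) (X τ : M) where
  carrier : Set (Ext E τ)
  inter_mem_iff' : ∀ (F : M) (P : Ext E τ), Sub E F τ → IsFin E F → IsInter E X P.1 F →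
    (P ∈ carrier ↔ ∀ Q : Ext E τ, E Q.1 F → Q ∈ carrier)
  union_mem_iff' : ∀ (C : M) (O : Ext E τ), Sub E C τ → IsUnion E O.1 C →
    (O ∈ carrier ↔ ∃ Q : Ext E τ, E Q.1 C ∧ Q ∈ carrier)
  empty_notMem' : ∀ O : Ext E τ, (∀ x, ¬ E x O.1) → O ∉ carrier
  whole_mem' : ∀ O : Ext E τ, O.1 = X → O ∈ carrier

namespace PointFilter

variable {E : M → M → Prop} {X τ : M}

instance : SetLike (PointFilter E X τ) (Ext E τ) where
  coe := carrier
  coe_injective p q h := by cases p; cases q; congr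

instance [Small.{w} (Ext E τ)] : Small.{w} (PointFilter E X τ) :=
  small_of_injective SetLike.coe_injective

/-- The point filter of all open sets which contain a point `x` of `X`. -/
def principal (x : Ext E X) : PointFilter E X τ where
  carrier := {O | E x.1 O.1}
  inter_mem_iff' F P hF _ hP :=
    ⟨fun h Q hQ => ((hP x).1 h).2 Q hQ, fun h => (hP x).2 ⟨x.2, fun Q hQ => h ⟨Q, hF Q hQ⟩ hQ⟩⟩
  union_mem_iff' C O hC hO :=
    ⟨fun h => let ⟨Q, hQ, hx⟩ := (hO x).1 h; ⟨⟨Q, hC Q hQ⟩, hQ, hx⟩,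
      fun ⟨Q, hQ, hx⟩ => (hO x).2 ⟨Q, hQ, hx⟩⟩
  empty_notMem' O hO := hO x
  whole_mem' _ hO := hO ▸ x.2

theorem mem_principal {x : Ext E X} {O : Ext E τ} : O ∈ principal x ↔ E x.1 O.1 := Iff.rfl

variable (p : PointFilter E X τ)

theorem inter_mem_iff {F : M} {P : Ext E τ} (hF : Sub E F τ) (hfin : IsFin E F)
    (hP : IsInter E X P.1 F) : P ∈ p ↔ ∀ Q : Ext E τ, E Q.1 F → Q ∈ p :=
  p.inter_mem_iff' F P hF hfin hP

theorem union_mem_iff {C : M} {O : Ext E τ} (hC : Sub E C τ) (hO : IsUnion E O.1 C) :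
    O ∈ p ↔ ∃ Q : Ext E τ, E Q.1 C ∧ Q ∈ p :=
  p.union_mem_iff' C O hC hO

theorem empty_notMem {O : Ext E τ} (hO : ∀ x, ¬ E x O.1) : O ∉ p := p.empty_notMem' O hO

theorem whole_mem {O : Ext E τ} (hO : O.1 = X) : O ∈ p := p.whole_mem' O hO

theorem mem_inter_iff (hpair : Pairing E) (hX : IsTopology E X τ) {O P Q : Ext E τ}
    (hQ : ∀ x, E x Q.1 ↔ E x O.1 ∧ E x P.1) : Q ∈ p ↔ O ∈ p ∧ P ∈ p := by
  obtain ⟨e, -, he⟩ := hX.empty_mem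
  obtain ⟨F, hF⟩ := hpair O.1 P.1
  have hFτ : Sub E F τ := fun x hx => by
    rcases (hF x).1 hx with rfl | rfl
    exacts [O.2, P.2]
  have hQF : IsInter E X Q.1 F := fun x => by
    have hOX := hX.sub O.1 O.2 x
    simp only [hQ, hF, forall_eq_or_imp, forall_eq]
    tauto
  rw [p.inter_mem_iff hFτ (hpair.isFin_pair he hF) hQF]
  simp [hF, ← Subtype.ext_iff]

theorem mem_or_mem_of_cover (hpair : Pairing E) (hX : IsTopology E X τ) {O P : Ext E τ}
    (hOP : ∀ x, E x X → E x O.1 ∨ E x P.1) : O ∈ p ∨ P ∈ p := by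
  obtain ⟨C, hC⟩ := hpair O.1 P.1
  have hCτ : Sub E C τ := fun x hx => by
    rcases (hC x).1 hx with rfl | rfl
    exacts [O.2, P.2]
  have hXC : IsUnion E X C := fun x => by
    have hOX := hX.sub O.1 O.2 x
    have hPX := hX.sub P.1 P.2 x
    simp only [hC, exists_eq_or_imp, exists_eq_left]
    exact ⟨hOP x, fun h => h.elim hOX hPX⟩
  have hXp : (⟨X, hX.whole_mem⟩ : Ext E τ) ∈ p := p.whole_mem rfl
  simpa [hC, ← Subtype.ext_iff] using (p.union_mem_iff hCτ hXC).1 hXp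

theorem notMem_of_disjoint (hpair : Pairing E) (hX : IsTopology E X τ) {O P : Ext E τ}
    (hOP : ∀ x, E x O.1 → ¬ E x P.1) (hO : O ∈ p) : P ∉ p := by
  obtain ⟨e, heτ, he⟩ := hX.empty_mem
  intro hP
  have hmeet : ∀ x, E x e ↔ E x O.1 ∧ E x P.1 := fun x =>
    ⟨fun h => (he x h).elim, fun h => (hOP x h.1 h.2).elim⟩
  exact p.empty_notMem he ((p.mem_inter_iff hpair hX (Q := ⟨e, heτ⟩) hmeet).2 ⟨hO, hP⟩)

variable (X) in
/-- The basic open set given by `O ∈ τ` in the space of all point filters. -/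
def basicOpen (O : Ext E τ) : Set (PointFilter E X τ) := {p | O ∈ p}

variable {p} in
theorem mem_basicOpen {O : Ext E τ} : p ∈ basicOpen X O ↔ O ∈ p := Iff.rfl

instance : TopologicalSpace (PointFilter E X τ) := .generateFrom (Set.range (basicOpen X))

theorem isTopologicalBasis_basicOpen (hpair : Pairing E) (hX : IsTopology E X τ) :
    TopologicalSpace.IsTopologicalBasis (Set.range (basicOpen X : Ext E τ → _)) where
  exists_subset_inter := by
    rintro _ ⟨O, rfl⟩ _ ⟨P, rfl⟩ p hp
    obtain ⟨Q, hQ, hQOP⟩ := hX.inter_mem O.1 P.1 O.2 P.2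
    have hmem (q : PointFilter E X τ) := q.mem_inter_iff hpair hX (Q := ⟨Q, hQ⟩) hQOP
    exact ⟨_, ⟨⟨Q, hQ⟩, rfl⟩, (hmem p).2 hp, fun q hq => (hmem q).1 hq⟩
  sUnion_eq := Set.eq_univ_of_forall fun p => ⟨_, ⟨⟨X, hX.whole_mem⟩, rfl⟩, p.whole_mem rfl⟩
  eq_generateFrom := rfl

instance : T0Space (PointFilter E X τ) where
  t0 _ _ h := SetLike.ext fun O =>
    h.mem_open_iff (TopologicalSpace.isOpen_generateFrom_of_mem ⟨O, rfl⟩)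

end PointFilter

end PointFilter

namespace Preinterpretation

variable {M : Type u} {E : M → M → Prop} {X τ : M}

/-- The point filter of all `O ∈ τ` with `y ∈ π(O)`, for a point `y` of the target space. -/
def filterAt (π : Preinterpretation.{u, w} E X τ) (y : π.Carrier) : PointFilter E X τ where
  carrier := {O | y ∈ π.op O}
  inter_mem_iff' F P hF hfin hP := by simp [π.map_inter F P hF hfin hP]
  union_mem_iff' C O hC hO := by simp [π.map_union C O hC hO]
  empty_notMem' O hO := by simp [π.map_empty O hO]
  whole_mem' O hO := by simp [π.map_whole O hO]

section Reductions

variable {π π₀ π₁ : Preinterpretation.{u, w} E X τ}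

theorem mem_filterAt {y : π.Carrier} {O : Ext E τ} : O ∈ π.filterAt y ↔ y ∈ π.op O := Iff.rfl

theorem filterAt_pt (x : Ext E X) : π.filterAt (π.pt x) = .principal x :=
  SetLike.ext fun O => (π.mem_iff x O).symm

theorem filterAt_injective : Function.Injective π.filterAt := fun _ _ h =>
  (π.basis.inseparable_iff.2 <| Set.forall_mem_range.2 fun O => SetLike.ext_iff.1 h O).eq

theorem isReduction_iff_filterAt {h : π₀.Carrier → π₁.Carrier} :
    IsReduction π₀ π₁ h ↔ ∀ y, π₁.filterAt (h y) = π₀.filterAt y := by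
  constructor
  · exact fun hh y => SetLike.ext fun O => Set.ext_iff.1 (hh.2 O) y
  · intro hh
    refine ⟨funext fun x => filterAt_injective ?_, fun O => Set.ext fun y => ?_⟩
    · rw [Function.comp_apply, hh, filterAt_pt, filterAt_pt]
    · exact SetLike.ext_iff.1 (hh y) O

theorem isInterpretation_of_filterAt_surjective (hπ : Function.Surjective π.filterAt) :
    π.IsInterpretation := fun π' =>
  ⟨fun y => Function.surjInv hπ (π'.filterAt y),
    isReduction_iff_filterAt.2 fun _ => Function.surjInv_eq hπ _⟩

theorem Reducible.equivalent (h₀₁ : Reducible π₀ π₁) (h₁₀ : Reducible π₁ π₀) :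
    Equivalent π₀ π₁ := by
  obtain ⟨f, hf⟩ := h₀₁
  obtain ⟨g, hg⟩ := h₁₀
  have hf' := isReduction_iff_filterAt.1 hf
  have hg' := isReduction_iff_filterAt.1 hg
  refine ⟨f, hf, Function.bijective_iff_has_inverse.2 ⟨g, fun y => ?_, fun z => ?_⟩⟩
  · exact filterAt_injective ((hg' _).trans (hf' y))
  · exact filterAt_injective ((hf' _).trans (hg' z))

theorem IsInterpretation.equivalent (h₀ : π₀.IsInterpretation) (h₁ : π₁.IsInterpretation) :
    π₀.Equivalent π₁ :=
  (h₁ π₀).equivalent (h₀ π₁)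

end Reductions

section Existence

variable [Small.{w} (Ext E τ)]

/-- The preinterpretation by the space of all point filters, shrunk to the universe `w`. -/
noncomputable def ofPointFilter (hpair : Pairing E) (hX : IsTopology E X τ) :
    Preinterpretation.{u, w} E X τ where
  Carrier := Shrink.{w} (PointFilter E X τ)
  t0 := (Shrink.homeomorph (PointFilter E X τ)).t0Space
  pt x := equivShrink _ (.principal x)
  op O := (equivShrink _).symm ⁻¹' PointFilter.basicOpen X O
  mem_iff x O := by simp [PointFilter.mem_basicOpen, PointFilter.mem_principal]
  map_inter F P hF hfin hP := by
    ext p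
    simpa [PointFilter.mem_basicOpen] using ((equivShrink _).symm p).inter_mem_iff hF hfin hP
  map_union C O hC hO := by
    ext p
    simpa [PointFilter.mem_basicOpen] using ((equivShrink _).symm p).union_mem_iff hC hO
  map_empty O hO := Set.eq_empty_of_forall_notMem fun _ => PointFilter.empty_notMem _ hO
  map_whole O hO := Set.eq_univ_of_forall fun _ => PointFilter.whole_mem _ hO
  basis := by
    rw [Set.range_comp' (Set.preimage _)]
    exact (PointFilter.isTopologicalBasis_basicOpen hpair hX).isInducing
      (Shrink.homeomorph (PointFilter E X τ)).symm.isInducing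

theorem isInterpretation_ofPointFilter (hpair : Pairing E) (hX : IsTopology E X τ) :
    (ofPointFilter.{u, w} hpair hX).IsInterpretation :=
  isInterpretation_of_filterAt_surjective fun p => ⟨equivShrink _ p, SetLike.ext fun O => by
    simp [ofPointFilter, mem_filterAt, PointFilter.mem_basicOpen]⟩

end Existence

section Regularity

variable (π : Preinterpretation.{u, w} E X τ)

theorem closure_op_subset (hpair : Pairing E) (hX : IsTopology E X τ) {P O : Ext E τ}
    (hPO : IsWellInside E X τ P.1 O.1) : closure (π.op P) ⊆ π.op O := by
  obtain ⟨Q, hQ, hPQ, hcover⟩ := hPO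
  have hclosed : IsClosed (π.op ⟨Q, hQ⟩)ᶜ := (π.basis.isOpen ⟨_, rfl⟩).isClosed_compl
  calc closure (π.op P)
      ⊆ (π.op ⟨Q, hQ⟩)ᶜ := closure_minimal
        (fun y hy => (π.filterAt y).notMem_of_disjoint hpair hX hPQ hy) hclosed
    _ ⊆ π.op O := fun y hy =>
        ((π.filterAt y).mem_or_mem_of_cover hpair hX (O := ⟨Q, hQ⟩) hcover).resolve_left hy

theorem exists_isWellInside_mem_op (hsep : Separation E) (hX : IsTopology E X τ)
    (hreg : IsRegular E X τ) {y : π.Carrier} {O : Ext E τ} (hy : y ∈ π.op O) :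
    ∃ P : Ext E τ, IsWellInside E X τ P.1 O.1 ∧ y ∈ π.op P := by
  obtain ⟨C, hC⟩ := hsep.exists_wellInside X τ O.1
  obtain ⟨P, hPC, hyP⟩ := ((π.filterAt y).union_mem_iff (fun P hP => ((hC P).1 hP).1)
    (hreg.isUnion_wellInside hsep hX O.2 hC)).1 hy
  exact ⟨P, ((hC P).1 hPC).2, hyP⟩

theorem t3Space (hpair : Pairing E) (hsep : Separation E) (hX : IsTopology E X τ)
    (hreg : IsRegular E X τ) : T3Space π.Carrier := by
  have : RegularSpace π.Carrier := .of_exists_mem_nhds_isClosed_subset fun y s hs => by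
    obtain ⟨_, ⟨O, rfl⟩, hyO, hOs⟩ := π.basis.mem_nhds_iff.1 hs
    obtain ⟨P, hPO, hyP⟩ := π.exists_isWellInside_mem_op hsep hX hreg hyO
    have hPy : closure (π.op P) ∈ nhds y :=
      Filter.mem_of_superset ((π.basis.isOpen ⟨P, rfl⟩).mem_nhds hyP) subset_closure
    exact ⟨_, hPy, isClosed_closure, (π.closure_op_subset hpair hX hPO).trans hOs⟩
  exact {}

end Regularity

end Preinterpretation

end SetModel

theorem mainTheorem1_general {M : Type u} (E : M → M → Prop) (hpair : SetModel.Pairing E)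
    (X τ : M) [Small.{w} (SetModel.Ext E τ)] (hX : SetModel.IsTopology E X τ) :
    (∃ π : SetModel.Preinterpretation.{u, w} E X τ, π.IsInterpretation) ∧
    (∀ π π' : SetModel.Preinterpretation.{u, w} E X τ,
      π.IsInterpretation → π'.IsInterpretation → π.Equivalent π') ∧
    (SetModel.Separation E → SetModel.IsRegular E X τ →
      ∀ π : SetModel.Preinterpretation.{u, w} E X τ, T3Space π.Carrier) :=
  ⟨⟨_, SetModel.Preinterpretation.isInterpretation_ofPointFilter hpair hX⟩,
    fun _ _ h h' => h.equivalent h', fun hsep hreg π => π.t3Space hpair hsep hX hreg⟩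

/-- `⟨M, E⟩` is a model of ZFC and `⟨X, τ⟩` is a regular Hausdorff space in it. The universe `w`
plays the role of the surrounding set-theoretic universe: `M` may be a proper class relative to
it, but (the extensions of) `X` and `τ` are sets. -/
theorem mainTheorem1 {M : Type u} (E : M → M → Prop) (hM : SetModel.IsModelZFC E) (X τ : M)
    [Small.{w} (SetModel.Ext E X)] [Small.{w} (SetModel.Ext E τ)]
    (hX : SetModel.IsRegularHausdorff E X τ) :
    (∃ π : SetModel.Preinterpretation.{u, w} E X τ, π.IsInterpretation) ∧
    (∀ π π' : SetModel.Preinterpretation.{u, w} E X τ,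
      π.IsInterpretation → π'.IsInterpretation → π.Equivalent π') ∧
    (∀ π : SetModel.Preinterpretation.{u, w} E X τ,
      π.IsInterpretation → RegularSpace π.Carrier ∧ T2Space π.Carrier) :=
  have ⟨hex, huniq, hT3⟩ := mainTheorem1_general E hM.pairing X τ hX.isTopology
  ⟨hex, huniq, fun π _ => have := hT3 hM.separation hX.regular π; ⟨inferInstance, inferInstance⟩⟩
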